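/- **Theorem 3.1.** Let $\mathfrak L$ be a left Leibniz algebra over a field $\mathbb F$ of characteristic zero, i.e. an $\mathbb F$-vector space with a bilinear multiplication satisfying $x(yz)=(xy)z+y(xz)$ for all $x,y,z\in\mathfrak L$. Let $\mathrm{Leib}(\mathfrak L):=\langle x^2\mid x\in\mathfrak L\rangle_{\mathbb F}$ be its Leibniz kernel; $\mathfrak L$ is called *semi-simple* if $\mathrm{Leib}(\mathfrak L)$ contains every solvable (two-sided) ideal of $\mathfrak L$ (for a Lie algebra: if $0$ is its only solvable ideal). Then the following statements are equivalent: (i) $\mathfrak L$ is finite-dimensional and semi-simple. (ii) There exists a finite-dimensional semi-simple Lie subalgebra $\mathfrak g$ of $\mathfrak L$ such that $\mathfrak L=\mathfrak g\oplus\mathrm{Leib}(\mathfrak L)$ as vector spaces, and $\mathrm{Leib}(\mathfrak L)$, with the left and right $\mathfrak g$-actions given by the multiplication of $\mathfrak L$, is a finite-dimensional completely reducible anti-symmetric $\mathfrak g$-bimodule (anti-symmetric: the right action is zero) that does not contain any non-zero trivial $\mathfrak g$-subbimodule (trivial: both actions are zero). (iii) There exist a finite-dimensional semi-simple Lie algebra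 $\mathfrak g$ over $\mathbb F$ and a finite-dimensional completely reducible left $\mathfrak g$-module $M$ that does not contain any non-zero trivial $\mathfrak g$-submodule such that $\mathfrak L$ is isomorphic, as an algebra, to the left hemi-semidirect product $\mathfrak g\ltimes_\ell M$, i.e. the vector space $\mathfrak g\times M$ with multiplication $(g,m)(g',m'):=([g,g'],\,g\cdot m')$. Here a (bi)module is *completely reducible* if each of its sub(bi)modules has a complementary sub(bi)module; the zero (bi)module is allowed. -/

import Mathlib

universe u v

/-- An algebra (a vector space with a bilinear, not necessarily associative multiplication) is a
left Leibniz algebra if every left multiplication is a derivation. -/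
class IsLeftLeibniz (L : Type*) [NonUnitalNonAssocRing L] : Prop where
  leibniz : ∀ x y z : L, x * (y * z) = (x * y) * z + y * (x * z)

section LeibnizAlgebra

variable (F : Type*) [Field F] (L : Type*) [NonUnitalNonAssocRing L] [Module F L]

/-- The Leibniz kernel: the linear span of all squares. -/
def leibnizKernel : Submodule F L :=
  Submodule.span F (Set.range fun x : L => x * x)

variable {F L}

/-- A (two-sided) ideal of an algebra. -/
structure IsTwoSidedIdeal (I : Submodule F L) : Prop where
  mul_mem_left : ∀ x : L, ∀ a ∈ I, x * a ∈ I
  mul_mem_right : ∀ x : L, ∀ a ∈ I, a * x ∈ I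

/-- The derived series of a subspace `I` (in use, an ideal): `I^(0) = I`, and `I^(n+1)` is the
linear span of all products of two elements of `I^(n)`. -/
def leibnizDerivedSeries (I : Submodule F L) : ℕ → Submodule F L
  | 0 => I
  | n + 1 => Submodule.span F
      {z | ∃ x ∈ leibnizDerivedSeries I n, ∃ y ∈ leibnizDerivedSeries I n, x * y = z}

/-- Solvability: the derived series reaches zero. -/
def IsSolvableSubspace (I : Submodule F L) : Prop :=
  ∃ n : ℕ, leibnizDerivedSeries I n = ⊥

variable (F L)

/-- A Leibniz algebra is semi-simple if its Leibniz kernel contains every solvable ideal. For a Lie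
algebra the Leibniz kernel is zero, so this says that there is no non-zero solvable ideal. -/
def IsSemisimpleLeibniz : Prop :=
  ∀ I : Submodule F L, IsTwoSidedIdeal I → IsSolvableSubspace I → I ≤ leibnizKernel F L

variable {F L}

/-- A subalgebra of a left Leibniz algebra is a Lie subalgebra if all its squares vanish, i.e. if
the multiplication restricted to it is alternating (the Jacobi identity then follows from the
Leibniz identity). -/
def IsLieSubalgebra (g : NonUnitalSubalgebra F L) : Prop :=
  ∀ x ∈ g, x * x = 0

instance (g : NonUnitalSubalgebra F L) [IsLeftLeibniz L] : IsLeftLeibniz g where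
  leibniz x y z := Subtype.ext (IsLeftLeibniz.leibniz (x : L) y z)

end LeibnizAlgebra

/-- A bimodule `M` over a left Leibniz algebra `L`: `left x m` is `x · m`, `right m x` is
`m · x`. -/
structure LeibnizBimodule (F : Type*) [Field F] (L : Type*) [NonUnitalNonAssocRing L] [Module F L]
    (M : Type*) [AddCommGroup M] [Module F M] where
  left : L →ₗ[F] M →ₗ[F] M
  right : M →ₗ[F] L →ₗ[F] M
  llm : ∀ (x y : L) (m : M), left (x * y) m = left x (left y m) - left y (left x m)
  lml : ∀ (x y : L) (m : M), right (left x m) y = left x (right m y) - right m (x * y)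
  mll : ∀ (x y : L) (m : M), right (right m x) y = right m (x * y) - left x (right m y)

namespace LeibnizBimodule

variable {F : Type*} [Field F] {L : Type*} [NonUnitalNonAssocRing L] [Module F L]
  {M : Type*} [AddCommGroup M] [Module F M]

/-- Subbimodules: subspaces stable under both actions. -/
structure IsSubbimodule (B : LeibnizBimodule F L M) (N : Submodule F M) : Prop where
  left_mem : ∀ x : L, ∀ m ∈ N, B.left x m ∈ N
  right_mem : ∀ x : L, ∀ m ∈ N, B.right m x ∈ N

/-- Complete reducibility: every subbimodule has a complementary subbimodule. -/
def IsCompletelyReducible (B : LeibnizBimodule F L M) : Prop :=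
  ∀ N : Submodule F M, B.IsSubbimodule N → ∃ N' : Submodule F M, B.IsSubbimodule N' ∧ IsCompl N N'

/-- Anti-symmetric: the right action is zero. -/
def IsAntisymmetric (B : LeibnizBimodule F L M) : Prop :=
  ∀ (m : M) (x : L), B.right m x = 0

/-- The only subbimodule on which both actions are zero is the zero one. -/
def HasNoNonzeroTrivialSubbimodule (B : LeibnizBimodule F L M) : Prop :=
  ∀ N : Submodule F M, B.IsSubbimodule N →
    (∀ m ∈ N, ∀ x : L, B.left x m = 0 ∧ B.right m x = 0) → N = ⊥

end LeibnizBimodule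

section KernelBimodule

variable {F : Type*} [Field F] {L : Type*} [NonUnitalNonAssocRing L] [Module F L]
  [IsScalarTower F L L] [SMulCommClass F L L] [IsLeftLeibniz L]

theorem leibnizKernel_mul_eq_zero {a : L} (ha : a ∈ leibnizKernel F L) (x : L) : a * x = 0 := by
  induction ha using Submodule.span_induction with
  | mem a h =>
    obtain ⟨y, rfl⟩ := h
    have := IsLeftLeibniz.leibniz y y x
    simpa using this
  | zero => simp
  | add a b _ _ iha ihb => rw [add_mul, iha, ihb, add_zero]
  | smul c a _ iha => rw [smul_mul_assoc, iha, smul_zero]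

theorem mul_mem_leibnizKernel (x : L) {a : L} (ha : a ∈ leibnizKernel F L) :
    x * a ∈ leibnizKernel F L := by
  induction ha using Submodule.span_induction with
  | mem a h =>
    obtain ⟨y, rfl⟩ := h
    have h : x * (y * y) = (x * y + y) * (x * y + y) - (x * y) * (x * y) - y * y := by
      rw [IsLeftLeibniz.leibniz x y y, add_mul, mul_add, mul_add]
      abel
    have hs : ∀ z : L, z * z ∈ leibnizKernel F L := fun z => Submodule.subset_span ⟨z, rfl⟩
    show x * (y * y) ∈ _
    rw [h]
    exact Submodule.sub_mem _ (Submodule.sub_mem _ (hs _) (hs _)) (hs _)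
  | zero => simp
  | add a b _ _ iha ihb => rw [mul_add]; exact Submodule.add_mem _ iha ihb
  | smul c a _ iha => rw [mul_smul_comm]; exact Submodule.smul_mem _ c iha

theorem leibnizKernel_mul_mem {a : L} (ha : a ∈ leibnizKernel F L) (x : L) :
    a * x ∈ leibnizKernel F L := by
  rw [leibnizKernel_mul_eq_zero ha x]; exact Submodule.zero_mem _

/-- The Leibniz kernel as a bimodule over a subalgebra `g`, both actions being given by the
multiplication of `L`. -/
def leibnizKernelBimodule (g : NonUnitalSubalgebra F L) :
    LeibnizBimodule F g (leibnizKernel F L) where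
  left := LinearMap.mk₂ F (fun x m => ⟨(x : L) * m, mul_mem_leibnizKernel _ m.2⟩)
    (fun x y m => Subtype.ext (add_mul (x : L) y m))
    (fun c x m => Subtype.ext (smul_mul_assoc c (x : L) m))
    (fun x m n => Subtype.ext (mul_add (x : L) m n))
    (fun c x m => Subtype.ext (mul_smul_comm c (x : L) m))
  right := LinearMap.mk₂ F (fun m x => ⟨(m : L) * x, leibnizKernel_mul_mem m.2 _⟩)
    (fun m n x => Subtype.ext (add_mul (m : L) n x))
    (fun c m x => Subtype.ext (smul_mul_assoc c (m : L) x))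
    (fun m x y => Subtype.ext (mul_add (m : L) x y))
    (fun c m x => Subtype.ext (mul_smul_comm c (m : L) x))
  llm x y m := Subtype.ext <| eq_sub_of_add_eq (IsLeftLeibniz.leibniz (x : L) y m).symm
  lml x y m := Subtype.ext <| eq_sub_of_add_eq (IsLeftLeibniz.leibniz (x : L) m y).symm
  mll x y m := Subtype.ext <| eq_sub_of_add_eq (IsLeftLeibniz.leibniz (m : L) x y).symm

end KernelBimodule

/-- The underlying vector space `g × M` of the left hemi-semidirect product of a Lie algebra `g`
and a left `g`-module `M`. -/
def HemiSemidirect (g M : Type*) : Type _ := g × M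

namespace HemiSemidirect

variable {F : Type*} [Field F] {g : Type*} [LieRing g] {M : Type*} [AddCommGroup M]

instance : AddCommGroup (HemiSemidirect g M) := inferInstanceAs (AddCommGroup (g × M))

instance [Module F g] [Module F M] : Module F (HemiSemidirect g M) :=
  inferInstanceAs (Module F (g × M))

variable [LieRingModule g M]

/-- The multiplication `(a, m) (b, n) = ([a, b], a · n)`. -/
instance : Mul (HemiSemidirect g M) :=
  ⟨fun p q => ((⁅p.1, q.1⁆, ⁅p.1, q.2⁆) : g × M)⟩

instance : NonUnitalNonAssocRing (HemiSemidirect g M) where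
  left_distrib p q r := Prod.ext (lie_add p.1 q.1 r.1) (lie_add p.1 q.2 r.2)
  right_distrib p q r := Prod.ext (add_lie p.1 q.1 r.1) (add_lie p.1 q.1 r.2)
  zero_mul p := Prod.ext (zero_lie p.1) (zero_lie p.2)
  mul_zero p := Prod.ext (lie_zero p.1) (lie_zero p.1)

instance : IsLeftLeibniz (HemiSemidirect g M) where
  leibniz p q r := Prod.ext (leibniz_lie p.1 q.1 r.1) (leibniz_lie p.1 q.1 r.2)

variable [LieAlgebra F g] [Module F M] [LieModule F g M]

instance : IsScalarTower F (HemiSemidirect g M) (HemiSemidirect g M) :=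
  ⟨fun c p q => Prod.ext (smul_lie c p.1 q.1) (smul_lie c p.1 q.2)⟩

instance : SMulCommClass F (HemiSemidirect g M) (HemiSemidirect g M) :=
  ⟨fun c p q => Prod.ext (lie_smul c p.1 q.1).symm (lie_smul c p.1 q.2).symm⟩

end HemiSemidirect

/-!
# Semi-simple Leibniz algebras are hemi-semidirect products

Write `K` for the Leibniz kernel of `L`. Elements of `K` multiply everything to zero from the left,
so `L ⧸ K` is a Lie algebra, `K` is a left module over it, and `L` is semi-simple exactly when `L ⧸
K` has no non-zero solvable ideal (`isSemisimpleLeibniz_iff_hasTrivialRadical`).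

The multiplication of `L` has to be split. A linear section `s` of `L → L ⧸ K` fails to be
multiplicative by `f p q = s p * s q - s ⁅p, q⁆`, and because `K * L = 0` the Leibniz identity says
that `p ↦ f p ·` is a derivation of `L ⧸ K` with values in the module `Hom(L ⧸ K, K)`. By
Whitehead's first lemma (`LieDerivation.exists_eq_lie`) this derivation is inner, given by some `φ`,
and `s - φ` is multiplicative (`exists_multiplicative_section`). So the second cohomology of Lie
algebras is not needed. The range of `s - φ` is the Lie subalgebra sought; complete reducibility of
`K` is Weyl's theorem (`LieAlgebra.complementedLattice_lieSubmodule`), again a consequence of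
Whitehead's first lemma. As `K` is spanned by the squares `(a + k) * (a + k) = a * k`, any
complement of a trivial submodule is all of `K`, so trivial submodules vanish.

Conversely, in `g ⋉ M` the square of `(a, m)` is `(0, ⁅a, m⁆)`, and complete reducibility without
trivial submodules gives `⁅g, M⁆ = M`; so the Leibniz kernel is `M` and the quotient by it is `g`.

Whitehead's first lemma is proved with the Casimir element. By Cartan's criterion the trace form of
`M` is non-degenerate on an ideal complementary to the kernel of the action, which gives an
invariant tensor in `g ⊗ g` whose action on `M` commutes with `g` and has non-zero trace when `M` is
not trivial (`LieAlgebra.exists_invariant_tensor`). Where this operator is invertible, derivations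
are inner by a direct formula; otherwise its kernel is a proper non-zero submodule and induction on
the dimension applies. On trivial modules derivations vanish because `g` is perfect.
-/

open scoped TensorProduct

universe w

/-! ### Cartan's criterion and the Casimir tensor -/

namespace LieAlgebra

section TraceForm

variable {F g M : Type*} [Field F] [CharZero F] [LieRing g] [LieAlgebra F g]
  [AddCommGroup M] [Module F M] [LieRingModule g M] [LieModule F g M]
  [FiniteDimensional F g] [FiniteDimensional F M]

section Cartan

attribute [local instance] LieRing.ofAssociativeRing

variable (F) in
/-- Cartan's criterion for a faithful module: the derived algebra acts nilpotently by
`LieModule.isNilpotent_derivedSeries_of_traceForm_eq_zero`, hence, the action being faithful, it is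
ad-nilpotent and Engel's theorem applies. -/
theorem isSolvable_of_traceForm_eq_zero (hinj : ∀ x : g, (∀ m : M, ⁅x, m⁆ = 0) → x = 0)
    (h : LieModule.traceForm F g M = 0) : IsSolvable g := by
  have hnil := LieModule.isNilpotent_derivedSeries_of_traceForm_eq_zero h
  rw [LieModule.isNilpotent_iff_forall' (R := F)] at hnil
  have : LieRing.IsNilpotent (derivedSeries F g 1) := by
    rw [LieAlgebra.isNilpotent_iff_forall (R := F)]
    intro x
    have hx := hnil x
    obtain ⟨n, hn⟩ := ad_nilpotent_of_nilpotent (R := F) hx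
    refine ⟨n, LinearMap.ext fun y => Subtype.ext (hinj _ fun m => ?_)⟩
    have key : ∀ k : ℕ, ∀ y : derivedSeries F g 1,
        LieModule.toEnd F (derivedSeries F g 1) M ((ad F _ x ^ k) y) =
          (ad F _ (LieModule.toEnd F (derivedSeries F g 1) M x) ^ k)
            (LieModule.toEnd F (derivedSeries F g 1) M y) := by
      intro k
      induction k with
      | zero => intro y; rfl
      | succ k ih =>
        intro y
        rw [pow_succ, pow_succ, Module.End.mul_apply, Module.End.mul_apply, ih, ad_apply, ad_apply,
          LieHom.map_lie]
    have := LinearMap.congr_fun (key n y) m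
    rw [hn] at this
    exact this
  obtain ⟨k, hk⟩ := IsSolvable.solvable F (derivedSeries F g 1)
  refine IsSolvable.mk (R := F) (k := k + 1) ?_
  rw [LieIdeal.derivedSeries_eq_bot_iff] at hk
  rw [derivedSeries_def, derivedSeriesOfIdeal_add]
  exact hk

end Cartan

variable [HasTrivialRadical F g]

variable (F g M) in
/-- The radical of the trace form meets `I` in an ideal that acts faithfully with vanishing trace
form, so in a solvable ideal. -/
theorem traceForm_restrict_nondegenerate (I : LieIdeal F g)
    (hI : IsCompl I (LieModule.ker F g M)) :
    ((LieModule.traceForm F g M).restrict I.toSubmodule).Nondegenerate := by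
  let J : LieIdeal F g := InvariantForm.orthogonal (LieModule.traceForm F g M)
    (LieModule.traceForm_lieInvariant F g M) ⊤
  have hJ : ∀ x, x ∈ J ↔ ∀ y, LieModule.traceForm F g M y x = 0 := fun x => by
    simp [J, InvariantForm.mem_orthogonal]
  have hsol : IsSolvable (I ⊓ J : LieIdeal F g) := by
    refine isSolvable_of_traceForm_eq_zero F (M := M) (fun x hx => ?_) ?_
    · have hx' : (x : g) ∈ I ⊓ LieModule.ker F g M :=
        ⟨x.2.1, (LieModule.mem_ker F g M _).2 hx⟩
      rw [hI.inf_eq_bot] at hx'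
      exact Subtype.ext hx'
    · ext x y
      exact (hJ y).1 y.2.2 x
  have hbot := HasTrivialRadical.eq_bot_of_isSolvable (R := F) (I ⊓ J)
  have hsymm : ((LieModule.traceForm F g M).restrict I.toSubmodule).IsSymm :=
    ⟨fun x y => LieModule.traceForm_comm F g M x y⟩
  refine hsymm.isRefl.nondegenerate_iff_separatingLeft.2 ?_
  intro x hx
  have hxJ : (x : g) ∈ J := by
    rw [hJ]
    intro y
    have hy : y ∈ I ⊔ LieModule.ker F g M := by rw [hI.sup_eq_top]; trivial
    obtain ⟨a, ha, k, hk, rfl⟩ := LieSubmodule.mem_sup _ _ _ |>.1 hy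
    have h1 : LieModule.traceForm F g M x a = 0 := hx ⟨a, ha⟩
    have h2 : LieModule.traceForm F g M k x = 0 := by
      rw [LieModule.traceForm_apply_apply, show LieModule.toEnd F g M k = 0 from hk,
        LinearMap.zero_comp, map_zero]
    rw [map_add, LinearMap.add_apply, h2, LieModule.traceForm_comm, h1, add_zero]
  have : (x : g) ∈ I ⊓ J := ⟨x.2, hxJ⟩
  rw [hbot] at this
  exact Subtype.ext this

variable (F g M) in
/-- The Casimir tensor of a non-trivial module `M`: the sum of `e i ⊗ e' i` over bases of an ideal
`I` complementary to the kernel that are dual with respect to the trace form. Its image under the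
trace form is the dimension of `I`. -/
theorem exists_invariant_tensor (hM : ¬ LieModule.IsTrivial g M) :
    ∃ t : g ⊗[F] g, (∀ x : g, ⁅x, t⁆ = 0) ∧
      TensorProduct.lift (LieModule.traceForm F g M) t ≠ 0 := by
  classical
  obtain ⟨I, hI⟩ : ∃ I : LieIdeal F g, IsCompl I (LieModule.ker F g M) :=
    ⟨_, (LieIdeal.isCompl_killingCompl (LieModule.ker F g M)).symm⟩
  set B := (LieModule.traceForm F g M).restrict I.toSubmodule
  have hnd : B.Nondegenerate := traceForm_restrict_nondegenerate F g M I hI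
  have hsymm : B.IsSymm := ⟨fun x y => LieModule.traceForm_comm F g M x y⟩
  let e := Module.finBasis F I.toSubmodule
  let e' := B.dualBasis hnd e
  have hexp : ∀ y : I.toSubmodule, (y : g) = ∑ j, B y (e' j) • (e j : g) := fun y => by
    have hr : ∀ j, e.repr y j = B y (e' j) := fun j => by
      rw [← LinearMap.BilinForm.dualBasis_dualBasis hnd hsymm e,
        LinearMap.BilinForm.dualBasis_repr_apply]
    conv_lhs => rw [← e.sum_repr y]
    simp [hr]
  have hexp' : ∀ y : I.toSubmodule, (y : g) = ∑ j, B y (e j) • (e' j : g) := fun y => by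
    conv_lhs => rw [← e'.sum_repr y]
    simp [e', LinearMap.BilinForm.dualBasis_repr_apply]
  refine ⟨∑ i, (e i : g) ⊗ₜ[F] (e' i : g), fun x => ?_, ?_⟩
  · have hx : ∀ y : I.toSubmodule, ⁅x, (y : g)⁆ ∈ I.toSubmodule := fun y => I.lie_mem y.2
    obtain ⟨c, h1, h2⟩ : ∃ c : Fin _ → Fin _ → F,
        (∀ i, ⁅x, (e i : g)⁆ = ∑ j, c i j • (e j : g)) ∧
          ∀ j, ⁅x, (e' j : g)⁆ = ∑ i, (-c i j) • (e' i : g) := by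
      refine ⟨fun i j => B ⟨_, hx (e i)⟩ (e' j), fun i => hexp ⟨_, hx (e i)⟩, fun j => ?_⟩
      refine (hexp' ⟨_, hx (e' j)⟩).trans (Finset.sum_congr rfl fun i _ => ?_)
      congr 1
      rw [eq_neg_iff_add_eq_zero, ← eq_neg_iff_add_eq_zero.1
        (LieModule.traceForm_apply_lie_apply' F g M x (e i) (e' j)), add_comm, ← hsymm.eq (e i)]
      rfl
    simp only [lie_sum, TensorProduct.LieModule.lie_tmul_right, h1, h2, TensorProduct.sum_tmul,
      TensorProduct.tmul_sum, Finset.sum_add_distrib, TensorProduct.smul_tmul,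
      TensorProduct.tmul_smul, TensorProduct.tmul_neg, neg_smul, Finset.sum_neg_distrib]
    rw [Finset.sum_comm, add_neg_cancel]
  · have h1 : ∀ i, LieModule.traceForm F g M (e i) (e' i) = 1 := fun i => by
      have := LinearMap.BilinForm.apply_dualBasis_right hnd hsymm e i i
      rwa [if_pos rfl] at this
    simp only [map_sum, TensorProduct.lift.tmul, h1, Finset.sum_const, Finset.card_univ,
      Fintype.card_fin, nsmul_eq_mul, mul_one]
    intro h0
    rw [Nat.cast_eq_zero, Submodule.finrank_eq_zero] at h0
    apply hM
    have : I = ⊥ := by simpa using h0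
    rw [this] at hI
    refine ⟨fun x m => ?_⟩
    have hx : x ∈ LieModule.ker F g M := by
      rw [← bot_sup_eq (LieModule.ker F g M), hI.sup_eq_top]; trivial
    exact (LieModule.mem_ker F g M x).1 hx m

end TraceForm

/-! ### Whitehead's first lemma -/

section Tensor

attribute [local instance] LieRing.ofAssociativeRing

variable {F g M : Type*} [Field F] [LieRing g] [LieAlgebra F g]
  [AddCommGroup M] [Module F M] [LieRingModule g M] [LieModule F g M]

variable (F g M) in
/-- The action of tensors on a module through the universal enveloping algebra: `a ⊗ b` acts by
`m ↦ ⁅a, ⁅b, m⁆⁆`. For an invariant tensor this is a Casimir operator. -/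
def tensorAction : g ⊗[F] g →ₗ[F] Module.End F M :=
  TensorProduct.lift ((LinearMap.mul F (Module.End F M)).compl₁₂
    (LieModule.toEnd F g M).toLinearMap (LieModule.toEnd F g M).toLinearMap)

@[simp]
theorem tensorAction_tmul (a b : g) (m : M) :
    tensorAction F g M (a ⊗ₜ b) m = ⁅a, ⁅b, m⁆⁆ := rfl

theorem trace_tensorAction (t : g ⊗[F] g) :
    LinearMap.trace F M (tensorAction F g M t) =
      TensorProduct.lift (LieModule.traceForm F g M) t := by
  induction t with
  | zero => simp
  | tmul a b => rfl
  | add s t hs ht => rw [map_add, map_add, map_add, hs, ht]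

theorem lie_tensorAction (x : g) (t : g ⊗[F] g) (m : M) :
    ⁅x, tensorAction F g M t m⁆ = tensorAction F g M ⁅x, t⁆ m + tensorAction F g M t ⁅x, m⁆ := by
  induction t with
  | zero => simp
  | tmul a b =>
    rw [TensorProduct.LieModule.lie_tmul_right, map_add, LinearMap.add_apply]
    simp only [tensorAction_tmul]
    rw [leibniz_lie x a, leibniz_lie x b, lie_add, add_assoc]
  | add s t hs ht =>
    simp only [map_add, lie_add, LinearMap.add_apply, hs, ht]
    abel

/-- For an invariant tensor `∑ aᵢ ⊗ bᵢ` the vector `∑ ⁅aᵢ, D bᵢ⁆` induces the inner derivation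
that is `D` followed by the Casimir operator. -/
theorem exists_lie_eq_tensorAction (D : LieDerivation F g M) (t : g ⊗[F] g)
    (ht : ∀ x : g, ⁅x, t⁆ = 0) : ∃ v : M, ∀ x, ⁅x, v⁆ = tensorAction F g M t (D x) := by
  let Ψ : g ⊗[F] g →ₗ[F] M := TensorProduct.lift
    ((LieModule.toEnd F g M : g →ₗ[F] Module.End F M).compl₂ (D : g →ₗ[F] M))
  have hΨ : ∀ a b : g, Ψ (a ⊗ₜ b) = ⁅a, D b⁆ := fun a b => rfl
  have key : ∀ (x : g) (s : g ⊗[F] g),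
      ⁅x, Ψ s⁆ = Ψ ⁅x, s⁆ + tensorAction F g M s (D x) := by
    intro x s
    induction s with
    | zero => simp
    | tmul a b =>
      rw [TensorProduct.LieModule.lie_tmul_right, map_add]
      simp only [tensorAction_tmul, hΨ, LieDerivation.apply_lie_eq_sub, lie_sub]
      rw [leibniz_lie x a]
      abel
    | add s t hs ht =>
      simp only [map_add, lie_add, LinearMap.add_apply, hs, ht]
      abel
  exact ⟨Ψ t, fun x => by rw [key, ht, map_zero, zero_add]⟩

end Tensor

variable {F g : Type*} [Field F] [CharZero F] [LieRing g] [LieAlgebra F g]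
  [FiniteDimensional F g] [HasTrivialRadical F g]

theorem derivedSeries_one_eq_top : derivedSeries F g 1 = ⊤ := by
  set I := derivedSeries F g 1
  have hc : IsCompl I I.killingCompl := LieIdeal.isCompl_killingCompl I
  have : IsLieAbelian I.killingCompl := by
    rw [LieSubmodule.lie_abelian_iff_lie_self_eq_bot, eq_bot_iff, ← hc.inf_eq_bot]
    exact le_inf (LieSubmodule.mono_lie le_top le_top) (LieSubmodule.lie_le_right _ _)
  have hb : I.killingCompl = ⊥ := HasTrivialRadical.eq_bot_of_isSolvable (R := F) _
  rw [← hc.sup_eq_top, hb, sup_bot_eq]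

/-- **Whitehead's first lemma**: derivations of a semi-simple Lie algebra with values in a
finite-dimensional module are inner. -/
theorem _root_.LieDerivation.exists_eq_lie (M : Type w) [AddCommGroup M] [Module F M]
    [LieRingModule g M] [LieModule F g M] [FiniteDimensional F M] (D : LieDerivation F g M) :
    ∃ v : M, ∀ x, D x = ⁅x, v⁆ := by
  induction hn : Module.finrank F M using Nat.strong_induction_on generalizing M with
  | _ n ih =>
  by_cases hM : LieModule.IsTrivial g M
  · -- On a trivial module derivations vanish on brackets, hence everywhere as `g` is perfect.
    refine ⟨0, fun x => ?_⟩
    have hx : x ∈ Submodule.span F {⁅u, v⁆ | (u : g) (v : g)} := by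
      rw [← coe_derivedSeries_one_eq, derivedSeries_one_eq_top]; trivial
    rw [lie_zero]
    refine (Submodule.span_le (p := LinearMap.ker (D : g →ₗ[F] M))).2 ?_ hx
    rintro _ ⟨u, v, rfl⟩
    simp [LieModule.IsTrivial.trivial]
  obtain ⟨t, ht, ht0⟩ := exists_invariant_tensor F g M hM
  rw [← trace_tensorAction] at ht0
  obtain ⟨v, hv⟩ := exists_lie_eq_tensorAction D t ht
  let K : LieSubmodule F g M :=
    { LinearMap.ker (tensorAction F g M t) with
      lie_mem := fun {x m} hm => by
        have := lie_tensorAction x t m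
        rw [ht, map_zero, LinearMap.zero_apply, zero_add, show tensorAction F g M t m = 0 from hm,
          lie_zero] at this
        exact this.symm }
  by_cases hK : K = ⊥
  · have hinj : Function.Injective (tensorAction F g M t) := by
      rw [← LinearMap.ker_eq_bot]
      exact congrArg LieSubmodule.toSubmodule hK
    obtain ⟨u, hu⟩ := LinearMap.surjective_of_injective hinj v
    refine ⟨u, fun x => hinj ?_⟩
    have := lie_tensorAction x t u
    rw [ht, map_zero, LinearMap.zero_apply, zero_add, hu, hv] at this
    exact this
  · have hKtop : K.toSubmodule ≠ ⊤ := by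
      intro h
      have : tensorAction F g M t = 0 := LinearMap.ker_eq_top.1 h
      exact ht0 (by rw [this, map_zero])
    have hKbot : K.toSubmodule ≠ ⊥ := by simpa using hK
    have hlt : Module.finrank F K < n := hn ▸ Submodule.finrank_lt hKtop
    have hlt' : Module.finrank F (M ⧸ K) < n := by
      have h1 := K.toSubmodule.finrank_quotient_add_finrank
      have h2 : 0 < Module.finrank F K.toSubmodule :=
        Nat.pos_of_ne_zero fun h => hKbot (Submodule.finrank_eq_zero.1 h)
      have h3 : Module.finrank F (M ⧸ K) = Module.finrank F (M ⧸ K.toSubmodule) := rfl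
      omega
    -- Subtract an inner derivation so that `D` takes values in `K`, then treat `K` itself.
    let D₁ : LieDerivation F g (M ⧸ K) :=
      { toLinearMap := (LieSubmodule.Quotient.mk' K : M →ₗ[F] M ⧸ K) ∘ₗ (D : g →ₗ[F] M)
        leibniz' := fun a b => congrArg (LieSubmodule.Quotient.mk' K) (D.leibniz' a b) }
    obtain ⟨w, hw⟩ := ih _ hlt' (M ⧸ K) D₁ rfl
    obtain ⟨u, rfl⟩ := LieSubmodule.Quotient.surjective_mk' K w
    let D₂ := D - LieDerivation.inner F g M u
    have hD₂ : ∀ x, D₂ x = D x - ⁅x, u⁆ := fun x => rfl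
    have hD₂K : ∀ x, D₂ x ∈ K := fun x => by
      rw [hD₂, ← LieSubmodule.Quotient.mk_eq_zero]
      exact (map_sub (LieSubmodule.Quotient.mk' K) _ _).trans (sub_eq_zero.2 (hw x))
    let D₃ : LieDerivation F g K :=
      { toLinearMap := (D₂ : g →ₗ[F] M).codRestrict K.toSubmodule hD₂K
        leibniz' := fun a b => Subtype.ext (D₂.leibniz' a b) }
    obtain ⟨k, hk⟩ := ih _ hlt K D₃ rfl
    refine ⟨u + k, fun x => ?_⟩
    have h : D₂ x = ⁅x, (k : M)⁆ := congrArg Subtype.val (hk x)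
    rw [lie_add, ← h, hD₂, add_sub_cancel]

/-! ### Weyl's theorem -/

/-- **Weyl's theorem** on complete reducibility. For a linear projection `p` onto `N`, the
derivation `x ↦ ⁅x, p⁆` takes values in the maps vanishing on `N`, so it is given by such a map `φ`,
and `p - φ` is an equivariant projection. -/
theorem complementedLattice_lieSubmodule (M : Type w) [AddCommGroup M] [Module F M]
    [LieRingModule g M] [LieModule F g M] [FiniteDimensional F M] :
    ComplementedLattice (LieSubmodule F g M) := by
  refine ⟨fun N => ?_⟩
  obtain ⟨p, hp⟩ := (N.incl : N →ₗ[F] M).exists_leftInverse_of_injective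
    (LinearMap.ker_eq_bot.2 Subtype.val_injective)
  have hp' : ∀ n : N, p n = n := fun n => LinearMap.congr_fun hp n
  let W : LieSubmodule F g (M →ₗ[F] N) :=
    { carrier := {φ | ∀ n : N, φ n = 0}
      add_mem' := fun {a b} ha hb n => by simp [ha n, hb n]
      zero_mem' := fun n => rfl
      smul_mem' := fun c a ha n => by simp [ha n]
      lie_mem := fun {x φ} hφ n => by
        have h := hφ ⁅x, n⁆
        rw [LieSubmodule.coe_bracket] at h
        rw [LieHom.lie_apply, hφ n, h, lie_zero, sub_zero] }
  let D₀ := LieDerivation.inner F g (M →ₗ[F] N) p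
  have hD₀ : ∀ x, D₀ x = ⁅x, p⁆ := fun x => rfl
  have hW : ∀ x, D₀ x ∈ W := fun x n => by
    have h := hp' ⁅x, n⁆
    rw [LieSubmodule.coe_bracket] at h
    rw [hD₀, LieHom.lie_apply, h, hp', sub_self]
  let D : LieDerivation F g W :=
    { toLinearMap := (D₀ : g →ₗ[F] (M →ₗ[F] N)).codRestrict W.toSubmodule hW
      leibniz' := fun a b => Subtype.ext (D₀.leibniz' a b) }
  obtain ⟨φ, hφ⟩ := LieDerivation.exists_eq_lie W D
  have hφ' : ∀ x, ⁅x, p⁆ = ⁅x, (φ : M →ₗ[F] N)⁆ := fun x => congrArg Subtype.val (hφ x)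
  let q : M →ₗ⁅F, g⁆ N :=
    { p - (φ : M →ₗ[F] N) with
      map_lie' := fun {x m} => by
        have h : ⁅x, p - (φ : M →ₗ[F] N)⁆ m = 0 := by rw [lie_sub, hφ', sub_self]; rfl
        rw [LieHom.lie_apply, sub_eq_zero] at h
        exact h.symm }
  have hq : ∀ n : N, q n = n := fun n => by
    change p n - (φ : M →ₗ[F] N) n = n
    rw [hp', φ.2 n, sub_zero]
  refine ⟨q.ker, ?_⟩
  rw [← LieSubmodule.isCompl_toSubmodule]
  exact LinearMap.isCompl_of_proj (f := (q : M →ₗ[F] N)) hq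

end LieAlgebra

/-! ### Semi-simplicity modulo the Leibniz kernel -/

section Radical

variable {F : Type*} [Field F] {L : Type*} [NonUnitalNonAssocRing L] [Module F L]
  [IsScalarTower F L L] [SMulCommClass F L L] [IsLeftLeibniz L]
  {g : Type*} [LieRing g] [LieAlgebra F g]

/-- Solvable ideals correspond under a surjection onto a Lie algebra whose kernel is the Leibniz
kernel: the derived series of the preimage of a solvable ideal reaches the Leibniz kernel, whose
products vanish. -/
theorem isSemisimpleLeibniz_iff_hasTrivialRadical (π : L →ₗ[F] g)
    (hsurj : Function.Surjective π) (hmul : ∀ x y, π (x * y) = ⁅π x, π y⁆)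
    (hker : LinearMap.ker π = leibnizKernel F L) :
    IsSemisimpleLeibniz F L ↔ LieAlgebra.HasTrivialRadical F g := by
  constructor
  · intro hL
    refine LieAlgebra.hasTrivialRadical_of_no_solvable_ideals fun I hI => ?_
    have hJ : IsTwoSidedIdeal (I.toSubmodule.comap π) :=
      ⟨fun x a ha => by
        change π (x * a) ∈ I
        rw [hmul]; exact lie_mem_right F g I _ _ ha,
      fun x a ha => by
        change π (a * x) ∈ I
        rw [hmul]; exact lie_mem_left F g I _ _ ha⟩
    have hle : ∀ n, leibnizDerivedSeries (I.toSubmodule.comap π) n ≤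
        (LieAlgebra.derivedSeriesOfIdeal F g n I).toSubmodule.comap π := by
      intro n
      induction n with
      | zero => exact le_rfl
      | succ n ih =>
        refine Submodule.span_le.2 ?_
        rintro _ ⟨x, hx, y, hy, rfl⟩
        change π (x * y) ∈ LieAlgebra.derivedSeriesOfIdeal F g (n + 1) I
        rw [hmul, LieAlgebra.derivedSeriesOfIdeal_succ]
        exact LieSubmodule.lie_mem_lie (ih hx) (ih hy)
    obtain ⟨k, hk⟩ := LieAlgebra.IsSolvable.solvable F I
    rw [LieIdeal.derivedSeries_eq_bot_iff] at hk
    have hsol : IsSolvableSubspace (I.toSubmodule.comap π) := by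
      refine ⟨k + 1, ?_⟩
      rw [eq_bot_iff]
      refine Submodule.span_le.2 ?_
      rintro _ ⟨x, hx, y, -, rfl⟩
      have hx' : x ∈ leibnizKernel F L := by
        have := hle k hx
        rw [hk] at this
        rw [← hker]
        exact this
      exact leibnizKernel_mul_eq_zero hx' y
    rw [eq_bot_iff]
    intro a ha
    obtain ⟨x, rfl⟩ := hsurj a
    have := hL _ hJ hsol ha
    rw [← hker] at this
    exact this
  · intro hg I hI hsol
    let J : LieIdeal F g :=
      { I.map π with
        lie_mem := fun {x a} ha => by
          obtain ⟨y, rfl⟩ := hsurj x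
          obtain ⟨b, hb, rfl⟩ := ha
          exact ⟨y * b, hI.mul_mem_left y b hb, hmul y b⟩ }
    have hle : ∀ n, (LieAlgebra.derivedSeriesOfIdeal F g n J).toSubmodule ≤
        (leibnizDerivedSeries I n).map π := by
      intro n
      induction n with
      | zero => exact le_rfl
      | succ n ih =>
        rw [LieAlgebra.derivedSeriesOfIdeal_succ, LieSubmodule.lieIdeal_oper_eq_linear_span',
          Submodule.span_le]
        rintro _ ⟨a, ha, b, hb, rfl⟩
        obtain ⟨x, hx, rfl⟩ := ih ha
        obtain ⟨y, hy, rfl⟩ := ih hb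
        exact ⟨x * y, Submodule.subset_span ⟨x, hx, y, hy, rfl⟩, hmul x y⟩
    obtain ⟨k, hk⟩ := hsol
    have hJ : LieAlgebra.derivedSeriesOfIdeal F g k J = ⊥ := by
      have := hle k
      rw [hk, Submodule.map_bot, le_bot_iff] at this
      simpa using this
    have : LieAlgebra.IsSolvable J :=
      LieAlgebra.IsSolvable.mk (R := F) ((LieIdeal.derivedSeries_eq_bot_iff J k).2 hJ)
    have hbot := LieAlgebra.HasTrivialRadical.eq_bot_of_isSolvable (R := F) J
    intro x hx
    rw [← hker]
    have hxJ : π x ∈ J := ⟨x, hx, rfl⟩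
    rw [hbot] at hxJ
    exact hxJ

end Radical

/-! ### Lie algebras as Leibniz algebras with vanishing squares -/

section Alternating

variable {F : Type*} [Field F] {A : Type*} [NonUnitalNonAssocRing A] [IsLeftLeibniz A]

/-- A left Leibniz algebra in which all squares vanish is a Lie ring, with its multiplication as the
bracket. -/
abbrev LieRing.ofMulSelfEqZero (h : ∀ x : A, x * x = 0) : LieRing A where
  bracket x y := x * y
  add_lie := add_mul
  lie_add := mul_add
  lie_self := h
  leibniz_lie := IsLeftLeibniz.leibniz

variable [Module F A] [IsScalarTower F A A] [SMulCommClass F A A]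

/-- The Lie algebra structure on `LieRing.ofMulSelfEqZero`. -/
abbrev LieAlgebra.ofMulSelfEqZero (h : ∀ x : A, x * x = 0) :
    letI := LieRing.ofMulSelfEqZero h
    LieAlgebra F A :=
  letI := LieRing.ofMulSelfEqZero h
  { lie_smul := fun c x y => mul_smul_comm c x y }

variable {M : Type*} [AddCommGroup M] [Module F M]

/-- The left action of a bimodule, as a module over the Lie ring `LieRing.ofMulSelfEqZero`. The
right action is forgotten. -/
abbrev LeibnizBimodule.lieRingModule (B : LeibnizBimodule F A M) (h : ∀ x : A, x * x = 0) :
    letI := LieRing.ofMulSelfEqZero h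
    LieRingModule A M :=
  letI := LieRing.ofMulSelfEqZero h
  { bracket := fun x m => B.left x m
    add_lie := fun x y m => by simp
    lie_add := fun x m n => by simp
    leibniz_lie := fun x y m => eq_add_of_sub_eq (B.llm x y m).symm }

end Alternating

/-! ### The Lie algebra of a Leibniz algebra and its splitting -/

section Quotient

variable {F : Type*} [Field F] {L : Type*} [NonUnitalNonAssocRing L] [Module F L]
  [IsScalarTower F L L] [SMulCommClass F L L] [IsLeftLeibniz L]

variable (F L) in
/-- The multiplication of `L` descended to the quotient by the Leibniz kernel. -/
def leibnizKernelQuotientBracket :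
    (L ⧸ leibnizKernel F L) →ₗ[F] (L ⧸ leibnizKernel F L) →ₗ[F] L ⧸ leibnizKernel F L :=
  (leibnizKernel F L).liftQ
    { toFun := fun x => (leibnizKernel F L).mapQ (leibnizKernel F L) (LinearMap.mulLeft F x)
        fun _ ha => mul_mem_leibnizKernel x ha
      map_add' := fun x y => Submodule.linearMap_qext _ <| LinearMap.ext fun z =>
        congrArg (leibnizKernel F L).mkQ (add_mul x y z)
      map_smul' := fun c x => Submodule.linearMap_qext _ <| LinearMap.ext fun z =>
        congrArg (leibnizKernel F L).mkQ (smul_mul_assoc c x z) }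
    fun _ ha => Submodule.linearMap_qext _ <| LinearMap.ext fun z =>
      congrArg (leibnizKernel F L).mkQ (leibnizKernel_mul_eq_zero ha z)

instance : Bracket (L ⧸ leibnizKernel F L) (L ⧸ leibnizKernel F L) :=
  ⟨fun p q => leibnizKernelQuotientBracket F L p q⟩

theorem leibnizKernel_mkQ_mul (x y : L) : (leibnizKernel F L).mkQ (x * y) =
    ⁅(leibnizKernel F L).mkQ x, (leibnizKernel F L).mkQ y⁆ := rfl

instance : LieRing (L ⧸ leibnizKernel F L) where
  add_lie p q r := by simp [Bracket.bracket]
  lie_add p q r := by simp [Bracket.bracket]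
  lie_self p := by
    obtain ⟨x, rfl⟩ := (leibnizKernel F L).mkQ_surjective p
    rw [← leibnizKernel_mkQ_mul, Submodule.mkQ_apply, Submodule.Quotient.mk_eq_zero]
    exact Submodule.subset_span ⟨x, rfl⟩
  leibniz_lie p q r := by
    obtain ⟨x, rfl⟩ := (leibnizKernel F L).mkQ_surjective p
    obtain ⟨y, rfl⟩ := (leibnizKernel F L).mkQ_surjective q
    obtain ⟨z, rfl⟩ := (leibnizKernel F L).mkQ_surjective r
    simp only [← leibnizKernel_mkQ_mul, ← map_add, IsLeftLeibniz.leibniz x y z]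

instance : LieAlgebra F (L ⧸ leibnizKernel F L) where
  lie_smul c p q := by simp [Bracket.bracket]

variable (F L) in
/-- The left multiplication of `L` on its Leibniz kernel, descended to the quotient by the kernel,
which acts as zero. -/
def leibnizKernelQuotientAction :
    (L ⧸ leibnizKernel F L) →ₗ[F] leibnizKernel F L →ₗ[F] leibnizKernel F L :=
  (leibnizKernel F L).liftQ
    { toFun := fun x => (LinearMap.mulLeft F x).restrict fun _ ha => mul_mem_leibnizKernel x ha
      map_add' := fun x y => LinearMap.ext fun z => Subtype.ext (add_mul x y (z : L))
      map_smul' := fun c x => LinearMap.ext fun z => Subtype.ext (smul_mul_assoc c x (z : L)) }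
    fun _ ha => LinearMap.ext fun z => Subtype.ext (leibnizKernel_mul_eq_zero ha (z : L))

instance : Bracket (L ⧸ leibnizKernel F L) (leibnizKernel F L) :=
  ⟨fun p m => leibnizKernelQuotientAction F L p m⟩

theorem leibnizKernel_coe_mkQ_lie (x : L) (m : leibnizKernel F L) :
    ((⁅(leibnizKernel F L).mkQ x, m⁆ : leibnizKernel F L) : L) = x * (m : L) := rfl

instance : LieRingModule (L ⧸ leibnizKernel F L) (leibnizKernel F L) where
  add_lie p q m := by simp [Bracket.bracket]
  lie_add p m n := by simp [Bracket.bracket]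
  leibniz_lie p q m := by
    obtain ⟨x, rfl⟩ := (leibnizKernel F L).mkQ_surjective p
    obtain ⟨y, rfl⟩ := (leibnizKernel F L).mkQ_surjective q
    rw [← leibnizKernel_mkQ_mul]
    exact Subtype.ext (IsLeftLeibniz.leibniz x y (m : L))

instance : LieModule F (L ⧸ leibnizKernel F L) (leibnizKernel F L) where
  smul_lie c p m := by simp [Bracket.bracket]
  lie_smul c p m := by simp [Bracket.bracket]

/-- The analogue of Levi's theorem for a semi-simple Leibniz algebra: the projection to the quotient
by the Leibniz kernel has a multiplicative linear section. -/
theorem exists_multiplicative_section [CharZero F] [FiniteDimensional F L]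
    [LieAlgebra.HasTrivialRadical F (L ⧸ leibnizKernel F L)] :
    ∃ s : (L ⧸ leibnizKernel F L) →ₗ[F] L, (∀ p, (leibnizKernel F L).mkQ (s p) = p) ∧
      ∀ p q, s p * s q = s ⁅p, q⁆ := by
  obtain ⟨s, hs⟩ := (leibnizKernel F L).mkQ.exists_rightInverse_of_surjective
    (leibnizKernel F L).range_mkQ
  have hs' : ∀ p, (leibnizKernel F L).mkQ (s p) = p := fun p => LinearMap.congr_fun hs p
  have hact : ∀ p (m : leibnizKernel F L), ((⁅p, m⁆ : leibnizKernel F L) : L) =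
      s p * (m : L) := fun p m => by
    conv_lhs => rw [← hs' p]
    rfl
  have hf : ∀ p q, s p * s q - s ⁅p, q⁆ ∈ leibnizKernel F L := fun p q => by
    rw [← Submodule.Quotient.mk_eq_zero, ← Submodule.mkQ_apply, map_sub, leibnizKernel_mkQ_mul,
      hs', hs', hs', sub_self]
  let f : (L ⧸ leibnizKernel F L) →ₗ[F] (L ⧸ leibnizKernel F L) →ₗ[F] leibnizKernel F L :=
    LinearMap.mk₂ F
    (fun p q => ⟨s p * s q - s ⁅p, q⁆, hf p q⟩)
    (fun p p' q => Subtype.ext <| by simp [add_mul, add_sub_add_comm])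
    (fun c p q => Subtype.ext <| by simp [smul_sub, smul_mul_assoc])
    (fun p q q' => Subtype.ext <| by simp [mul_add, add_sub_add_comm])
    (fun c p q => Subtype.ext <| by simp [smul_sub, mul_smul_comm])
  have hfc : ∀ p q, (f p q : L) = s p * s q - s ⁅p, q⁆ := fun p q => rfl
  let D : LieDerivation F (L ⧸ leibnizKernel F L)
      ((L ⧸ leibnizKernel F L) →ₗ[F] leibnizKernel F L) :=
    { toLinearMap := f
      leibniz' := fun p q => by
        refine LinearMap.ext fun r => Subtype.ext ?_
        rw [LinearMap.sub_apply, LieHom.lie_apply, LieHom.lie_apply]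
        push_cast
        have h1 := IsLeftLeibniz.leibniz (s p) (s q) (s r)
        have h2 : s p * s q = f p q + s ⁅p, q⁆ := by rw [hfc]; abel
        -- The only term of the Leibniz identity with `f` on the left vanishes, since `K * L = 0`.
        have h3 : (f p q : L) * s r = 0 := leibnizKernel_mul_eq_zero (f p q).2 _
        rw [h2, add_mul, h3, zero_add] at h1
        simp only [hact, hfc, mul_sub, h1, leibniz_lie p q r, map_add]
        abel }
  obtain ⟨φ, hφ⟩ := LieDerivation.exists_eq_lie _ D
  have hφ' : ∀ p q, s p * s q - s ⁅p, q⁆ = s p * (φ q : L) - φ ⁅p, q⁆ := fun p q => by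
    have h := congrArg Subtype.val (LinearMap.congr_fun (hφ p) q)
    rw [LieHom.lie_apply] at h
    push_cast at h
    rw [hact] at h
    exact h
  refine ⟨s - (leibnizKernel F L).subtype ∘ₗ φ, fun p => ?_, fun p q => ?_⟩
  · rw [LinearMap.sub_apply, map_sub, hs', LinearMap.comp_apply, Submodule.subtype_apply,
      Submodule.mkQ_apply,
      (Submodule.Quotient.mk_eq_zero (leibnizKernel F L)).2 (φ p).2, sub_zero]
  · have h1 : ∀ z, (φ p : L) * z = 0 := leibnizKernel_mul_eq_zero (φ p).2
    have h2 := hφ' p q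
    simp only [LinearMap.sub_apply, LinearMap.comp_apply, Submodule.subtype_apply, sub_mul, mul_sub,
      h1, sub_zero]
    rw [sub_eq_sub_iff_add_eq_add] at h2 ⊢
    rw [add_comm] at h2
    rw [← sub_eq_zero] at h2 ⊢
    rw [← h2]; abel

end Quotient

/-! ### Hemi-semidirect products -/

section Semidirect

/-- A complement of the submodule spanned by all `⁅x, n⁆` is a trivial module. -/
theorem LieSubmodule.span_lie_eq_top {F g M : Type*} [Field F] [LieRing g] [LieAlgebra F g]
    [AddCommGroup M] [Module F M] [LieRingModule g M] [LieModule F g M]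
    [ComplementedLattice (LieSubmodule F g M)]
    (h : ∀ N : LieSubmodule F g M, LieModule.IsTrivial g N → N = ⊥) :
    Submodule.span F {m : M | ∃ (x : g) (n : M), ⁅x, n⁆ = m} = ⊤ := by
  obtain ⟨N, hN⟩ := exists_isCompl (⁅(⊤ : LieIdeal F g), (⊤ : LieSubmodule F g M)⁆)
  have hbot : N = ⊥ := h N ⟨fun x n => Subtype.ext <| by
    have : ⁅x, (n : M)⁆ ∈ ⁅(⊤ : LieIdeal F g), (⊤ : LieSubmodule F g M)⁆ ⊓ N :=
      ⟨LieSubmodule.lie_mem_lie (LieSubmodule.mem_top x) (LieSubmodule.mem_top (n : M)),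
        N.lie_mem n.2⟩
    rw [hN.inf_eq_bot] at this
    exact this⟩
  have htop := hN.sup_eq_top
  rw [hbot, sup_bot_eq] at htop
  rw [eq_top_iff, ← LieSubmodule.top_toSubmodule (R := F) (L := g), ← htop,
    LieSubmodule.lieIdeal_oper_eq_linear_span']
  refine Submodule.span_mono ?_
  rintro _ ⟨x, -, n, -, rfl⟩
  exact ⟨x, n, rfl⟩

variable {F : Type*} [Field F] {L : Type*} [NonUnitalNonAssocRing L] [Module F L]

theorem leibnizKernel_eq_ker_of_equiv_hemiSemidirect {g M : Type*} [LieRing g] [LieAlgebra F g]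
    [AddCommGroup M] [Module F M] [LieRingModule g M] [LieModule F g M]
    (e : L ≃ₗ[F] HemiSemidirect g M) (he : ∀ x y, e (x * y) = e x * e y)
    (hspan : Submodule.span F {m : M | ∃ (x : g) (n : M), ⁅x, n⁆ = m} = ⊤) :
    LinearMap.ker ((LinearMap.fst F g M : HemiSemidirect g M →ₗ[F] g) ∘ₗ e.toLinearMap) =
      leibnizKernel F L := by
  refine le_antisymm (fun x hx => ?_) (Submodule.span_le.2 ?_)
  · have hx1 : (e x).1 = 0 := hx
    have hle : (⊤ : Submodule F M) ≤ (leibnizKernel F L).comap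
        (e.symm.toLinearMap ∘ₗ (LinearMap.inr F g M : M →ₗ[F] HemiSemidirect g M)) := by
      rw [← hspan, Submodule.span_le]
      rintro _ ⟨a, m, rfl⟩
      let p : HemiSemidirect g M := ((a, m) : g × M)
      let q : HemiSemidirect g M := ((0, ⁅a, m⁆) : g × M)
      refine Submodule.subset_span ⟨e.symm p, e.injective ?_⟩
      change e (e.symm p * e.symm p) = e (e.symm q)
      rw [he, e.apply_symm_apply, e.apply_symm_apply]
      exact Prod.ext (lie_self a) rfl
    have := hle (Submodule.mem_top (x := (e x).2))
    have hx2 : e.symm (((0 : g), (e x).2) : g × M) = x :=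
      e.symm_apply_eq.2 (Prod.ext hx1.symm rfl)
    rw [← hx2]
    exact this
  · rintro _ ⟨x, rfl⟩
    change (e (x * x)).1 = 0
    rw [he]
    exact lie_self (e x).1

variable [IsScalarTower F L L] [SMulCommClass F L L] [IsLeftLeibniz L]

theorem finiteDimensional_and_semisimple_of_equiv_hemiSemidirect {g M : Type*} [LieRing g]
    [LieAlgebra F g] [AddCommGroup M] [Module F M] [LieRingModule g M] [LieModule F g M]
    [FiniteDimensional F g] [LieAlgebra.HasTrivialRadical F g] [FiniteDimensional F M]
    [ComplementedLattice (LieSubmodule F g M)]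
    (h : ∀ N : LieSubmodule F g M, LieModule.IsTrivial g N → N = ⊥)
    (e : L ≃ₗ[F] HemiSemidirect g M) (he : ∀ x y, e (x * y) = e x * e y) :
    FiniteDimensional F L ∧ IsSemisimpleLeibniz F L := by
  have : FiniteDimensional F (HemiSemidirect g M) :=
    inferInstanceAs (FiniteDimensional F (g × M))
  refine ⟨e.symm.finiteDimensional, ?_⟩
  refine (isSemisimpleLeibniz_iff_hasTrivialRadical
    ((LinearMap.fst F g M : HemiSemidirect g M →ₗ[F] g) ∘ₗ e.toLinearMap) (fun a => ?_)
    (fun x y => ?_) (leibnizKernel_eq_ker_of_equiv_hemiSemidirect e he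
      (LieSubmodule.span_lie_eq_top h))).2 inferInstance
  · exact ⟨e.symm (((a, 0) : g × M) : HemiSemidirect g M),
      congrArg Prod.fst (e.apply_symm_apply ((a, 0) : g × M))⟩
  · exact congrArg Prod.fst (he x y)

end Semidirect

/-! ### Lie complements of the Leibniz kernel -/

section Complement

variable {F : Type*} [Field F] {L : Type*} [NonUnitalNonAssocRing L] [Module F L]
  [IsScalarTower F L L] [SMulCommClass F L L] [IsLeftLeibniz L]

theorem leibnizKernelBimodule_isAntisymmetric (g : NonUnitalSubalgebra F L) :
    (leibnizKernelBimodule g).IsAntisymmetric :=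
  fun m x => Subtype.ext (leibnizKernel_mul_eq_zero m.2 (x : L))

theorem leibnizKernelBimodule_isSubbimodule_iff {g : NonUnitalSubalgebra F L}
    {N : Submodule F (leibnizKernel F L)} :
    (leibnizKernelBimodule g).IsSubbimodule N ↔
      ∀ x : g, ∀ m ∈ N, (leibnizKernelBimodule g).left x m ∈ N := by
  refine ⟨fun h => h.left_mem, fun h => ⟨h, fun x m _ => ?_⟩⟩
  rw [leibnizKernelBimodule_isAntisymmetric g m x]
  exact N.zero_mem

/-- For a Lie subalgebra, semi-simplicity as a Leibniz algebra is semi-simplicity of any Lie algebra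
it is identified with. -/
theorem isSemisimpleLeibniz_iff_of_isLieSubalgebra {g : NonUnitalSubalgebra F L}
    {g' : Type*} [LieRing g'] [LieAlgebra F g'] (hg : IsLieSubalgebra g) (e : g ≃ₗ[F] g')
    (he : ∀ x y, e (x * y) = ⁅e x, e y⁆) :
    IsSemisimpleLeibniz F g ↔ LieAlgebra.HasTrivialRadical F g' := by
  refine isSemisimpleLeibniz_iff_hasTrivialRadical e.toLinearMap e.surjective he ?_
  rw [LinearEquiv.ker, eq_comm, leibnizKernel, Submodule.span_eq_bot]
  rintro _ ⟨x, rfl⟩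
  exact Subtype.ext (hg x x.2)

/-- A complement of a trivial subbimodule contains all squares `(a + k) * (a + k) = a * k`, which
span the Leibniz kernel. -/
theorem leibnizKernelBimodule_hasNoNonzeroTrivialSubbimodule {g : NonUnitalSubalgebra F L}
    (hg : IsLieSubalgebra g) (hc : g.toSubmodule ⊔ leibnizKernel F L = ⊤)
    (hr : (leibnizKernelBimodule g).IsCompletelyReducible) :
    (leibnizKernelBimodule g).HasNoNonzeroTrivialSubbimodule := by
  intro N hN htriv
  obtain ⟨N', hN', hNN'⟩ := hr N hN
  have hle : leibnizKernel F L ≤ N'.map (leibnizKernel F L).subtype := by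
    refine Submodule.span_le.2 ?_
    rintro _ ⟨x, rfl⟩
    have hx : x ∈ g.toSubmodule ⊔ leibnizKernel F L := hc ▸ Submodule.mem_top
    obtain ⟨a, ha, k, hk, rfl⟩ := Submodule.mem_sup.1 hx
    have hk' : (⟨k, hk⟩ : leibnizKernel F L) ∈ N ⊔ N' := by
      rw [hNN'.sup_eq_top]; exact Submodule.mem_top
    obtain ⟨n, hn, n', hn', hkn⟩ := Submodule.mem_sup.1 hk'
    refine ⟨(leibnizKernelBimodule g).left ⟨a, ha⟩ n', hN'.left_mem _ _ hn', ?_⟩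
    have h1 : a * (n : L) = 0 := congrArg Subtype.val (htriv n hn ⟨a, ha⟩).1
    have h2 : (n : L) + n' = k := congrArg Subtype.val hkn
    change a * (n' : L) = (a + k) * (a + k)
    rw [add_mul, leibnizKernel_mul_eq_zero hk, mul_add, hg a ha, ← h2, mul_add, h1]
    simp
  rw [eq_bot_iff, ← hNN'.inf_eq_bot]
  refine le_inf le_rfl fun n _ => ?_
  obtain ⟨n', hn', h⟩ := hle n.2
  rwa [← Subtype.ext h]

theorem exists_lieSubalgebra_isCompl_leibnizKernel [CharZero F] [FiniteDimensional F L]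
    (hL : IsSemisimpleLeibniz F L) :
    ∃ g : NonUnitalSubalgebra F L, IsLieSubalgebra g ∧ IsSemisimpleLeibniz F g ∧
      IsCompl g.toSubmodule (leibnizKernel F L) ∧
      (leibnizKernelBimodule g).IsCompletelyReducible := by
  have hrad : LieAlgebra.HasTrivialRadical F (L ⧸ leibnizKernel F L) :=
    (isSemisimpleLeibniz_iff_hasTrivialRadical (leibnizKernel F L).mkQ
      (leibnizKernel F L).mkQ_surjective leibnizKernel_mkQ_mul (leibnizKernel F L).ker_mkQ).1 hL
  obtain ⟨s, hs, hmul⟩ := exists_multiplicative_section (F := F) (L := L)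
  let g : NonUnitalSubalgebra F L :=
    { LinearMap.range s with
      mul_mem' := by
        rintro _ _ ⟨p, rfl⟩ ⟨q, rfl⟩
        exact ⟨⁅p, q⁆, (hmul p q).symm⟩ }
  have hcompl : IsCompl g.toSubmodule (leibnizKernel F L) := by
    refine IsCompl.of_eq ?_ ?_
    · rw [eq_bot_iff]
      rintro _ ⟨⟨p, rfl⟩, hp⟩
      have h0 : p = 0 := by rw [← hs p]; exact (Submodule.Quotient.mk_eq_zero _).2 hp
      rw [h0, map_zero]
      exact Submodule.zero_mem _
    · rw [eq_top_iff]
      intro x _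
      rw [← add_sub_cancel (s ((leibnizKernel F L).mkQ x)) x]
      refine Submodule.add_mem_sup ⟨_, rfl⟩ ?_
      rw [← Submodule.Quotient.mk_eq_zero, ← Submodule.mkQ_apply, map_sub, hs, sub_self]
  have hg : IsLieSubalgebra g := by
    rintro _ ⟨p, rfl⟩
    rw [hmul, lie_self, map_zero]
  let e : (L ⧸ leibnizKernel F L) ≃ₗ[F] g :=
    LinearEquiv.ofInjective s (Function.LeftInverse.injective hs)
  refine ⟨g, hg, ?_, hcompl, fun N hN => ?_⟩
  · refine (isSemisimpleLeibniz_iff_of_isLieSubalgebra hg e.symm fun x y => ?_).2 hrad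
    obtain ⟨p, rfl⟩ := e.surjective x
    obtain ⟨q, rfl⟩ := e.surjective y
    rw [e.symm_apply_apply, e.symm_apply_apply, e.symm_apply_eq]
    exact Subtype.ext (hmul p q)
  · have hstab : ∀ N : Submodule F (leibnizKernel F L),
        (leibnizKernelBimodule g).IsSubbimodule N ↔
          ∀ (p : L ⧸ leibnizKernel F L), ∀ m ∈ N, ⁅p, m⁆ ∈ N := by
      intro N
      have hact : ∀ p (m : leibnizKernel F L), (leibnizKernelBimodule g).left (e p) m = ⁅p, m⁆ :=
        fun p m => by
          conv_rhs => rw [← hs p]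
          rfl
      rw [leibnizKernelBimodule_isSubbimodule_iff, e.surjective.forall]
      simp only [hact]
    have := LieAlgebra.complementedLattice_lieSubmodule (F := F) (g := L ⧸ leibnizKernel F L)
      (leibnizKernel F L)
    obtain ⟨N', hN'⟩ := exists_isCompl
      ({ N with lie_mem := fun {p m} hm => (hstab N).1 hN p m hm } :
        LieSubmodule F (L ⧸ leibnizKernel F L) (leibnizKernel F L))
    exact ⟨N'.toSubmodule, (hstab _).2 fun p m hm => N'.lie_mem hm,
      LieSubmodule.isCompl_toSubmodule.2 hN'⟩

end Complement

/-! ### The characterization of semi-simple Leibniz algebras -/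

theorem theorem3p1 {F : Type u} [Field F] [CharZero F]
    {L : Type v} [NonUnitalNonAssocRing L] [Module F L]
    [IsScalarTower F L L] [SMulCommClass F L L] [IsLeftLeibniz L] :
    List.TFAE [
      FiniteDimensional F L ∧ IsSemisimpleLeibniz F L,
      ∃ g : NonUnitalSubalgebra F L,
        IsLieSubalgebra g ∧ FiniteDimensional F g ∧ IsSemisimpleLeibniz F g ∧
        IsCompl g.toSubmodule (leibnizKernel F L) ∧
        FiniteDimensional F (leibnizKernel F L) ∧
        (leibnizKernelBimodule g).IsAntisymmetric ∧
        (leibnizKernelBimodule g).IsCompletelyReducible ∧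
        (leibnizKernelBimodule g).HasNoNonzeroTrivialSubbimodule,
      ∃ (g : Type v) (_ : LieRing g) (_ : LieAlgebra F g)
        (M : Type v) (_ : AddCommGroup M) (_ : Module F M)
        (_ : LieRingModule g M) (_ : LieModule F g M),
        FiniteDimensional F g ∧ LieAlgebra.HasTrivialRadical F g ∧
        FiniteDimensional F M ∧ ComplementedLattice (LieSubmodule F g M) ∧
        (∀ N : LieSubmodule F g M, LieModule.IsTrivial g N → N = ⊥) ∧
        ∃ e : L ≃ₗ[F] HemiSemidirect g M, ∀ x y : L, e (x * y) = e x * e y] := by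
  tfae_have 1 → 2 := by
    rintro ⟨_, hL⟩
    obtain ⟨g, hg, hss, hc, hr⟩ := exists_lieSubalgebra_isCompl_leibnizKernel hL
    exact ⟨g, hg, inferInstanceAs (FiniteDimensional F g.toSubmodule), hss, hc, inferInstance,
      leibnizKernelBimodule_isAntisymmetric g, hr,
      leibnizKernelBimodule_hasNoNonzeroTrivialSubbimodule hg hc.sup_eq_top hr⟩
  tfae_have 2 → 3 := by
    rintro ⟨g, hg, hfin, hss, hc, hfinK, -, hr, hnt⟩
    have hsq : ∀ x : g, x * x = 0 := fun x => Subtype.ext (hg x x.2)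
    let := LieRing.ofMulSelfEqZero hsq
    let := LieAlgebra.ofMulSelfEqZero (F := F) hsq
    let := (leibnizKernelBimodule g).lieRingModule hsq
    have hmod : LieModule F g (leibnizKernel F L) :=
      { smul_lie := fun c x m => Subtype.ext (smul_mul_assoc c (x : L) (m : L))
        lie_smul := fun c x m => Subtype.ext (mul_smul_comm c (x : L) (m : L)) }
    have hsub : ∀ N : LieSubmodule F g (leibnizKernel F L),
        (leibnizKernelBimodule g).IsSubbimodule N.toSubmodule := fun N =>
      leibnizKernelBimodule_isSubbimodule_iff.2 fun x m hm => N.lie_mem hm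
    refine ⟨g, inferInstance, inferInstance, leibnizKernel F L, inferInstance, inferInstance,
      inferInstance, hmod, hfin, ?_, hfinK, ⟨fun N => ?_⟩, fun N hN => ?_, ?_⟩
    · exact (isSemisimpleLeibniz_iff_of_isLieSubalgebra hg (LinearEquiv.refl F g)
        fun _ _ => rfl).1 hss
    · obtain ⟨N', hN', hNN'⟩ := hr N.toSubmodule (hsub N)
      exact ⟨{ N' with lie_mem := fun {x m} hm => hN'.left_mem x m hm },
        LieSubmodule.isCompl_toSubmodule.1 hNN'⟩
    · have := hnt N.toSubmodule (hsub N) fun m hm x =>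
        ⟨congrArg Subtype.val (hN.trivial x ⟨m, hm⟩), leibnizKernelBimodule_isAntisymmetric g m x⟩
      simpa using this
    · let e : HemiSemidirect g (leibnizKernel F L) ≃ₗ[F] L :=
        Submodule.prodEquivOfIsCompl _ _ hc
      have he : ∀ p q : HemiSemidirect g (leibnizKernel F L), e (p * q) = e p * e q := by
        rintro ⟨a, m⟩ ⟨b, n⟩
        change (a : L) * b + (a : L) * n = ((a : L) + m) * ((b : L) + n)
        rw [add_mul, leibnizKernel_mul_eq_zero m.2, mul_add, add_zero]
      refine ⟨e.symm, fun x y => ?_⟩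
      obtain ⟨p, rfl⟩ := e.surjective x
      obtain ⟨q, rfl⟩ := e.surjective y
      rw [← he p q, e.symm_apply_apply, e.symm_apply_apply, e.symm_apply_apply]
  tfae_have 3 → 1 := by
    rintro ⟨g, _, _, M, _, _, _, _, _, _, _, _, hnt, e, he⟩
    exact finiteDimensional_and_semisimple_of_equiv_hemiSemidirect hnt e he
  tfae_finish
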